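/- Let $G$ be a connected (finite-dimensional, real) solvable Lie group with identity $e$ and Lie algebra $\mathfrak g=T_eG$. A flow of automorphisms of $G$ is a one-parameter subgroup $\varphi=\{\varphi_t\}_{t\in\mathbb R}$ of the group $\mathrm{Aut}(G)$ of Lie group automorphisms of $G$, i.e. $\varphi_{s+t}=\varphi_s\circ\varphi_t$, $\varphi_0=\mathrm{id}$, each $\varphi_t$ is a smooth automorphism and $(t,g)\mapsto\varphi_t(g)$ is continuous; $\varphi$ is nilpotent if the linear map $\mathcal D:\mathfrak g\to\mathfrak g$ determined by $(d\varphi_t)_e=e^{t\mathcal D}$ for all $t\in\mathbb R$ is nilpotent. For a neighborhood $U$ of $e$ and $\tau>0$, a $(U,\tau)$-chain from $x$ to $y$ consists of an integer $n\ge 1$, points $x=x_0,x_1,\ldots,x_n=y$ of $G$ and times $\tau_0,\ldots,\tau_{n-1}\ge\tau$ such that $x_{i+1}^{-1}\varphi_{\tau_i}(x_i)\in U$ for $i=0,\ldots,n-1$. Let $\Omega(x)$ be the set of all $y\in G$ such that for every neighborhood $U$ of $e$ and every $\tau>0$ there is a $(U,\tau)$-chain from $x$ to $y$, and let $\mathcal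 R_C(\varphi)=\{x\in G: x\in\Omega(x)\}$. On $\mathcal R_C(\varphi)$ put $x\sim y$ if and only if $x\in\Omega(y)$ and $y\in\Omega(x)$. The flow $\varphi$ is chain transitive if $G$ is contained in a single equivalence class of $\sim$. Then every nilpotent flow of automorphisms $\varphi$ on $G$ is chain transitive. -/

import Mathlib

open scoped Manifold ContDiff Topology

noncomputable section

variable {E : Type*} [NormedAddCommGroup E] [NormedSpace ℝ E]
  {H : Type*} [TopologicalSpace H] (I : ModelWithCorners ℝ E H)
  (G : Type*) [TopologicalSpace G] [ChartedSpace H G] [Group G]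

/-- A flow of automorphisms of the Lie group `G`: a one-parameter subgroup `t ↦ φ_t`, `t ∈ ℝ`, of
the group of Lie group automorphisms of `G`. Each `φ_t` is a smooth group homomorphism (with smooth
inverse `φ_{-t}`), and continuity of the one-parameter subgroup is continuity of
`(t, g) ↦ φ_t g` on `ℝ × G`, which is part of `Flow ℝ G`. -/
structure AutomorphismFlow extends Flow ℝ G where
  map_mul' : ∀ (t : ℝ) (g h : G), toFun t (g * h) = toFun t g * toFun t h
  contMDiff' : ∀ t : ℝ, ContMDiff I I ∞ (toFun t)

namespace AutomorphismFlow

variable {I G}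

instance : CoeFun (AutomorphismFlow I G) fun _ => ℝ → G → G := ⟨fun φ => φ.toFun⟩

/-- The differential `(dφ_t)_e` as an endomorphism of the Lie algebra `T_e G`. Its codomain is a
priori `T_{φ_t e} G`, which is `T_e G` since `φ_t e = e`. In Mathlib, `TangentSpace I g` is by
definition the model space `E`, read in the preferred chart at `g`; the Lie algebra of `G` is
written as `E` here because `TangentSpace` carries no norm. -/
def differentialAtOne (φ : AutomorphismFlow I G) (t : ℝ) : E →L[ℝ] E :=
  mfderiv I I (φ t) (1 : G)

/-- `D` is the infinitesimal generator of `φ` on the Lie algebra `T_e G = E`: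
`(dφ_t)_e = e^{tD}` for all `t`. Such a `D` is unique, and it is automatically a derivation. -/
def IsAssociatedDerivation (φ : AutomorphismFlow I G) (D : E →L[ℝ] E) : Prop :=
  ∀ t : ℝ, φ.differentialAtOne t = NormedSpace.exp (t • D)

/-- A flow of automorphisms is nilpotent if its associated derivation is nilpotent. -/
def IsNilpotentFlow (φ : AutomorphismFlow I G) : Prop :=
  ∃ D : E →L[ℝ] E, φ.IsAssociatedDerivation D ∧ IsNilpotent D

/-- There is a `(U, τ)`-chain from `x` to `y`: a number `n ≥ 1` of jumps, points `x_0, …, x_n` and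
times `τ_0, …, τ_{n-1} ≥ τ` with `x_0 = x`, `x_n = y` and `x_{i+1}⁻¹ φ_{τ_i}(x_i) ∈ U`. -/
def ExistsChain (φ : AutomorphismFlow I G) (U : Set G) (τ : ℝ) (x y : G) : Prop :=
  ∃ (n : ℕ) (p : ℕ → G) (T : ℕ → ℝ), 1 ≤ n ∧ p 0 = x ∧ p n = y ∧
    ∀ i < n, τ ≤ T i ∧ (p (i + 1))⁻¹ * φ (T i) (p i) ∈ U

/-- The chain limit set `Ω(x)`. -/
def chainLimitSet (φ : AutomorphismFlow I G) (x : G) : Set G :=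
  {y | ∀ U ∈ 𝓝 (1 : G), ∀ τ : ℝ, 0 < τ → φ.ExistsChain U τ x y}

/-- The chain recurrent set. -/
def chainRecurrentSet (φ : AutomorphismFlow I G) : Set G :=
  {x | x ∈ φ.chainLimitSet x}

/-- The chain transitive component of `x` (for `x` chain recurrent): the class of `x` under
`x ∼ y ↔ x ∈ Ω(y) ∧ y ∈ Ω(x)` on the chain recurrent set. -/
def chainComponent (φ : AutomorphismFlow I G) (x : G) : Set G :=
  {y | y ∈ φ.chainRecurrentSet ∧ x ∈ φ.chainLimitSet y ∧ y ∈ φ.chainLimitSet x}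

/-- A set is chain transitive if it is contained in a chain transitive component. -/
def IsChainTransitiveSet (φ : AutomorphismFlow I G) (F : Set G) : Prop :=
  ∃ x ∈ φ.chainRecurrentSet, F ⊆ φ.chainComponent x

/-- The flow is chain transitive if the whole group is a chain transitive set. -/
def IsChainTransitive (φ : AutomorphismFlow I G) : Prop :=
  φ.IsChainTransitiveSet Set.univ

end AutomorphismFlow

end

/-! A jump replaces `x` by `φ_T(x) u⁻¹` with `u` in `U`. Hence every product `φ_{S₁}(u₁) ⋯
φ_{Sₙ}(uₙ)` with small `uᵢ` and decreasing, well separated positive times can be reached from `1`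
(`transGen_of_flowProduct`). Similar products for the reversed flow, whose generator `-D` is also
nilpotent, lead back to `1`. It remains to write every element as such a product
(`exists_flowProduct`).

Nilpotency enters through `(1 - e^{qD})^m = 0`: it gives `1 = ∑ c_k e^{kqD}` with `c_k` independent
of `q`. Where the exponential is additive, `exp(sX)` is therefore the product of the `φ_{kq}(exp(c_k
s X))`. Taking `s = t/N` with `N` large makes all `exp(c_k s X)` small, however large `q` is, and
the `N`-th power recovers `exp(tX)`.

Solvability reduces to this abelian case along the closed derived series. Its terms are
flow-invariant and topologically generated by one-parameter subgroups
(`topologicalClosure_commutator_le`). Flow products form an open set, so it is enough to treat a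
dense subgroup of each term modulo the next one.

The Lie theory needed rests on one limit, `a(t/n)^n → γ(t)` for a curve `a` with the velocity of `γ`
(`IsOneParam.exists_tendsto_pow`). -/

/-! ### One-parameter subgroups and multiplication in the chart at the identity -/

section OneParameter

open Filter Set

variable {E : Type*} [NormedAddCommGroup E] [NormedSpace ℝ E]
  {H : Type*} [TopologicalSpace H] (I : ModelWithCorners ℝ E H)
  {G : Type*} [TopologicalSpace G] [ChartedSpace H G] [Group G]

/-- `γ` is a one-parameter subgroup of `G` with initial velocity `X`, read in the preferred chart
at the identity. -/
structure IsOneParam (γ : ℝ → G) (X : E) : Prop where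
  map_add : ∀ s t, γ (s + t) = γ s * γ t
  continuous : Continuous γ
  hasStrictDerivAt : HasStrictDerivAt (fun t => extChartAt I (1 : G) (γ t)) X 0

namespace IsOneParam

variable {I} {γ : ℝ → G} {X : E}

theorem map_zero (h : IsOneParam I γ X) : γ 0 = 1 := by
  have := h.map_add 0 0
  simpa using this

theorem map_neg (h : IsOneParam I γ X) (t : ℝ) : γ (-t) = (γ t)⁻¹ := by
  rw [eq_inv_iff_mul_eq_one, ← h.map_add, neg_add_cancel, h.map_zero]

theorem map_nsmul (h : IsOneParam I γ X) (n : ℕ) (t : ℝ) : γ (n * t) = γ t ^ n := by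
  induction n with
  | zero => simp [h.map_zero]
  | succ n ih => rw [pow_succ, ← ih, ← h.map_add]; congr 1; push_cast; ring

theorem comp_mul (h : IsOneParam I γ X) (c : ℝ) : IsOneParam I (fun t => γ (c * t)) (c • X) where
  map_add s t := by rw [mul_add, h.map_add]
  continuous := h.continuous.comp (continuous_const.mul continuous_id)
  hasStrictDerivAt := by
    have h1 : HasStrictDerivAt (fun t : ℝ => c * t) c 0 := by
      simpa using (hasStrictDerivAt_id (0 : ℝ)).const_mul c
    have h2 : HasStrictDerivAt (fun t => extChartAt I (1 : G) (γ t)) X (c * 0) := by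
      simpa using h.hasStrictDerivAt
    exact h2.scomp 0 h1

end IsOneParam

/-- The derivative at the identity of a map fixing the identity, as an endomorphism of the model
space. -/
noncomputable def derivAtOne (f : G → G) : E →L[ℝ] E := mfderiv I I f (1 : G)

/-- The group multiplication read in the preferred chart at the identity. -/
noncomputable def chartMul (G : Type*) [TopologicalSpace G] [ChartedSpace H G] [Group G]
    (p : E × E) : E :=
  extChartAt I (1 : G) ((extChartAt I (1 : G)).symm p.1 * (extChartAt I (1 : G)).symm p.2)

theorem eventually_extChartAt_mul {W : Type*} [TopologicalSpace W] {a b : W → G} {w : W}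
    (ha : ContinuousAt a w) (hb : ContinuousAt b w) (ha1 : a w = 1) (hb1 : b w = 1) :
    ∀ᶠ x in 𝓝 w, extChartAt I (1 : G) (a x * b x) =
      chartMul I G (extChartAt I (1 : G) (a x), extChartAt I (1 : G) (b x)) := by
  have hs : (extChartAt I (1 : G)).source ∈ 𝓝 (1 : G) := extChartAt_source_mem_nhds (1 : G)
  filter_upwards [ha.preimage_mem_nhds (by rwa [ha1]), hb.preimage_mem_nhds (by rwa [hb1])]
    with x hx hy
  simp only [chartMul, (extChartAt I (1 : G)).left_inv hx, (extChartAt I (1 : G)).left_inv hy]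

variable [I.Boundaryless] [LieGroup I ∞ G]

theorem extChartAt_one_symm_contMDiffAt :
    ContMDiffAt 𝓘(ℝ, E) I ∞ (extChartAt I (1 : G)).symm (extChartAt I (1 : G) 1) :=
  (contMDiffOn_extChartAt_symm (1 : G)).contMDiffAt
    ((isOpen_extChartAt_target (1 : G)).mem_nhds (mem_extChartAt_target (1 : G)))

theorem contDiffAt_chartMul :
    ContDiffAt ℝ ∞ (chartMul I G) (extChartAt I (1 : G) 1, extChartAt I (1 : G) 1) := by
  rw [← contMDiffAt_iff_contDiffAt]
  have h1 : ContMDiffAt 𝓘(ℝ, E × E) I ∞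
      (fun p : E × E => (extChartAt I (1 : G)).symm p.1)
      (extChartAt I (1 : G) 1, extChartAt I (1 : G) 1) :=
    ContMDiffAt.comp (I' := 𝓘(ℝ, E)) _ (extChartAt_one_symm_contMDiffAt I)
      contDiff_fst.contMDiff.contMDiffAt
  have h2 : ContMDiffAt 𝓘(ℝ, E × E) I ∞
      (fun p : E × E => (extChartAt I (1 : G)).symm p.2)
      (extChartAt I (1 : G) 1, extChartAt I (1 : G) 1) :=
    ContMDiffAt.comp (I' := 𝓘(ℝ, E)) _ (extChartAt_one_symm_contMDiffAt I)
      contDiff_snd.contMDiff.contMDiffAt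
  refine ContMDiffAt.comp (I' := I) (g := extChartAt I (1 : G)) _ ?_ (h1.mul h2)
  simp only [extChartAt_to_inv, mul_one]
  exact contMDiffAt_extChartAt

/-- Fixing one variable at the identity makes the product the identity map in the other, which
determines both partial derivatives. -/
theorem hasStrictFDerivAt_chartMul :
    HasStrictFDerivAt (chartMul I G)
      (ContinuousLinearMap.fst ℝ E E + ContinuousLinearMap.snd ℝ E E)
      (extChartAt I (1 : G) 1, extChartAt I (1 : G) 1) := by
  set z := extChartAt I (1 : G) 1 with hz
  have h := (contDiffAt_chartMul (I := I) (G := G)).hasStrictFDerivAt (by simp)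
  rw [← hz] at h
  have hev : ∀ᶠ x in 𝓝 z, x ∈ (extChartAt I (1 : G)).target :=
    (isOpen_extChartAt_target (1 : G)).mem_nhds (mem_extChartAt_target (1 : G))
  have h1 : HasFDerivAt (fun x : E => chartMul I G (x, z)) (ContinuousLinearMap.id ℝ E) z := by
    refine (hasFDerivAt_id z).congr_of_eventuallyEq ?_
    filter_upwards [hev] with x hx
    simp only [chartMul, hz, extChartAt_to_inv, mul_one,
      (extChartAt I (1 : G)).right_inv hx, id]
  have h2 : HasFDerivAt (fun x : E => chartMul I G (z, x)) (ContinuousLinearMap.id ℝ E) z := by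
    refine (hasFDerivAt_id z).congr_of_eventuallyEq ?_
    filter_upwards [hev] with x hx
    simp only [chartMul, hz, extChartAt_to_inv, one_mul,
      (extChartAt I (1 : G)).right_inv hx, id]
  have e1 := h1.unique (h.hasFDerivAt.comp (f := fun x => (x, z)) z (hasFDerivAt_prodMk_left z z))
  have e2 := h2.unique (h.hasFDerivAt.comp (f := fun x => (z, x)) z (hasFDerivAt_prodMk_right z z))
  have e3 : fderiv ℝ (chartMul I G) (z, z) =
      ContinuousLinearMap.fst ℝ E E + ContinuousLinearMap.snd ℝ E E := by
    ext x
    · simpa using (DFunLike.congr_fun e1 x).symm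
    · simpa using (DFunLike.congr_fun e2 x).symm
  rwa [e3] at h

theorem hasStrictFDerivAt_extChartAt_mul {W : Type*} [NormedAddCommGroup W] [NormedSpace ℝ W]
    {a b : W → G} {w : W} {A B : W →L[ℝ] E}
    (ha : ContinuousAt a w) (hb : ContinuousAt b w) (ha1 : a w = 1) (hb1 : b w = 1)
    (hA : HasStrictFDerivAt (fun x => extChartAt I (1 : G) (a x)) A w)
    (hB : HasStrictFDerivAt (fun x => extChartAt I (1 : G) (b x)) B w) :
    HasStrictFDerivAt (fun x => extChartAt I (1 : G) (a x * b x)) (A + B) w := by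
  have h := hasStrictFDerivAt_chartMul I (G := G)
  have h' : HasStrictFDerivAt (chartMul I G)
      (ContinuousLinearMap.fst ℝ E E + ContinuousLinearMap.snd ℝ E E)
      (extChartAt I (1 : G) (a w), extChartAt I (1 : G) (b w)) := by rwa [ha1, hb1]
  have h2 := h'.comp w (hA.prodMk hB)
  have h3 := h2.congr_of_eventuallyEq
    ((eventually_extChartAt_mul I ha hb ha1 hb1).mono fun x hx => hx.symm)
  exact h3.congr_fderiv (by ext x; simp)

theorem hasStrictDerivAt_extChartAt_mul
    {a b : ℝ → G} {w : ℝ} {A B : E}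
    (ha : ContinuousAt a w) (hb : ContinuousAt b w) (ha1 : a w = 1) (hb1 : b w = 1)
    (hA : HasStrictDerivAt (fun x => extChartAt I (1 : G) (a x)) A w)
    (hB : HasStrictDerivAt (fun x => extChartAt I (1 : G) (b x)) B w) :
    HasStrictDerivAt (fun x => extChartAt I (1 : G) (a x * b x)) (A + B) w := by
  have := (hasStrictFDerivAt_extChartAt_mul I ha hb ha1 hb1 hA.hasStrictFDerivAt
    hB.hasStrictFDerivAt).hasStrictDerivAt
  simpa using this

/-- The derivative at the identity of a smooth map fixing the identity, read in the chart. -/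
theorem hasStrictDerivAt_extChartAt_comp {f : G → G} (hf : ContMDiff I I ∞ f) (hf1 : f 1 = 1)
    {a : ℝ → G} {A : E} (ha : ContinuousAt a 0) (ha1 : a 0 = 1)
    (hA : HasStrictDerivAt (fun x => extChartAt I (1 : G) (a x)) A 0) :
    HasStrictDerivAt (fun x => extChartAt I (1 : G) (f (a x))) (derivAtOne I f A) 0 := by
  have h1 : ContDiffAt ℝ ∞ (fun x => extChartAt I (1 : G) (f ((extChartAt I (1 : G)).symm x)))
      (extChartAt I (1 : G) 1) := by
    rw [← contMDiffAt_iff_contDiffAt]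
    refine ContMDiffAt.comp (I' := I) (g := extChartAt I (1 : G)) _ ?_
      ((hf.contMDiffAt).comp _ (extChartAt_one_symm_contMDiffAt I))
    simp only [extChartAt_to_inv, hf1]
    exact contMDiffAt_extChartAt
  have h2 := h1.hasStrictFDerivAt (by simp)
  -- `mfderiv` reads the target in the chart at `f 1`, which is the chart at `1` because `f 1 = 1`.
  have e : derivAtOne I f =
      fderiv ℝ (fun x => extChartAt I (1 : G) (f ((extChartAt I (1 : G)).symm x)))
        (extChartAt I (1 : G) 1) := by
    have h4 := ((hf.contMDiffAt (x := 1)).mdifferentiableAt (by simp)).hasMFDerivAt.2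
    simp only [writtenInExtChartAt, I.range_eq_univ, hf1] at h4
    have h5 : HasFDerivAt
        (fun x => extChartAt I (1 : G) (f ((extChartAt I (1 : G)).symm x)))
        (derivAtOne I f) (extChartAt I (1 : G) 1) := hasFDerivWithinAt_univ.1 h4
    exact h5.unique h2.hasFDerivAt
  rw [e]
  have h3 : HasStrictFDerivAt
      (fun x => extChartAt I (1 : G) (f ((extChartAt I (1 : G)).symm x)))
      (fderiv ℝ (fun x => extChartAt I (1 : G) (f ((extChartAt I (1 : G)).symm x)))
        (extChartAt I (1 : G) 1)) (extChartAt I (1 : G) (a 0)) := by rwa [ha1]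
  refine (h3.comp_hasStrictDerivAt 0 hA).congr_of_eventuallyEq ?_
  have hs : (extChartAt I (1 : G)).source ∈ 𝓝 (1 : G) := extChartAt_source_mem_nhds (1 : G)
  filter_upwards [ha.preimage_mem_nhds (by rwa [ha1])] with x hx
  simp only [Function.comp_apply, (extChartAt I (1 : G)).left_inv hx]

namespace IsOneParam

variable {I} {γ : ℝ → G} {X : E}

/-- The image of a one-parameter subgroup under a smooth homomorphism. -/
theorem map (h : IsOneParam I γ X) (f : G →* G) (hf : ContMDiff I I ∞ f) :
    IsOneParam I (fun t => f (γ t)) (derivAtOne I f X) where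
  map_add s t := by rw [h.map_add, f.map_mul]
  continuous := hf.continuous.comp h.continuous
  hasStrictDerivAt := hasStrictDerivAt_extChartAt_comp I hf f.map_one h.continuous.continuousAt
    h.map_zero h.hasStrictDerivAt

end IsOneParam

end OneParameter

/-! ### Existence of one-parameter subgroups -/

section OneParameterExistence

open Filter Set

variable {E : Type*} [NormedAddCommGroup E] [NormedSpace ℝ E]
  {H : Type*} [TopologicalSpace H] (I : ModelWithCorners ℝ E H)
  {G : Type*} [TopologicalSpace G] [ChartedSpace H G] [Group G]
  [I.Boundaryless] [LieGroup I ∞ G]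

/-- A continuous homomorphism from the reals which is differentiable at the origin is strictly
differentiable there. -/
theorem isOneParam_of_hasDerivAt {γ : ℝ → G} {X : E} (hadd : ∀ s t, γ (s + t) = γ s * γ t)
    (hc : Continuous γ) (hd : HasDerivAt (fun t => extChartAt I (1 : G) (γ t)) X 0) :
    IsOneParam I γ X := by
  refine ⟨hadd, hc, ?_⟩
  have h0 : γ 0 = 1 := by simpa using hadd 0 0
  set z := extChartAt I (1 : G) 1 with hz
  set y : ℝ → E := fun t => extChartAt I (1 : G) (γ t) with hy
  have hy0 : y 0 = z := by simp [hy, h0, hz]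
  have hyc : ContinuousAt y 0 := hd.continuousAt
  have hF : ContDiffAt ℝ 1 (chartMul I G) (z, z) := (contDiffAt_chartMul I).of_le (by simp)
  have hpair : Tendsto (fun t => (y t, z)) (𝓝 0) (𝓝 (z, z)) := by
    have : ContinuousAt (fun t => (y t, z)) 0 := hyc.prodMk continuousAt_const
    simpa [ContinuousAt, hy0] using this
  have hdiff : ∀ᶠ t in 𝓝 (0 : ℝ), DifferentiableAt ℝ (chartMul I G) (y t, z) :=
    hpair.eventually ((hF.eventually (by simp)).mono fun p hp => hp.differentiableAt (by simp))
  have hsrc : ∀ᶠ t in 𝓝 (0 : ℝ), γ t ∈ (extChartAt I (1 : G)).source :=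
    hc.continuousAt.preimage_mem_nhds (by rw [h0]; exact extChartAt_source_mem_nhds (1 : G))
  -- Since `γ s = γ t * γ (s - t)`, the derivative at `t` is obtained from the derivative at `0` by
  -- a formula continuous in `t`.
  have hder : ∀ᶠ t in 𝓝 (0 : ℝ),
      HasDerivAt y (fderiv ℝ (chartMul I G) (y t, z) (0, X)) t := by
    filter_upwards [hdiff, hsrc] with t ht hts
    have h1 : HasDerivAt (fun s => (y t, y (s - t))) ((0 : E), X) t := by
      have h2 : HasDerivAt (fun s => y (s - t)) X t := by
        have h3 : HasDerivAt y X (t - t) := by simpa using hd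
        simpa [Function.comp_def] using
          HasDerivAt.scomp (h := fun s => s - t) t h3 ((hasDerivAt_id t).sub_const t)
      exact (hasDerivAt_const t (y t)).prodMk h2
    have h4 : HasFDerivAt (chartMul I G) (fderiv ℝ (chartMul I G) (y t, z)) (y t, y (t - t)) := by
      rw [sub_self, hy0]; exact ht.hasFDerivAt
    refine (h4.comp_hasDerivAt t h1).congr_of_eventuallyEq ?_
    have h5 : ∀ᶠ s in 𝓝 t, γ (s - t) ∈ (extChartAt I (1 : G)).source := by
      have : Tendsto (fun s => s - t) (𝓝 t) (𝓝 0) := by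
        simpa using (continuous_id.sub continuous_const).tendsto (f := fun s : ℝ => s - t) t
      exact this.eventually hsrc
    filter_upwards [h5] with s hs
    have : γ s = γ t * γ (s - t) := by rw [← hadd]; congr 1; ring
    simp only [Function.comp_apply, hy, chartMul, (extChartAt I (1 : G)).left_inv hts,
      (extChartAt I (1 : G)).left_inv hs, this]
  have hcd : ContinuousAt (fun t => fderiv ℝ (chartMul I G) (y t, z) (0, X)) 0 := by
    have h1 : ContinuousAt (fderiv ℝ (chartMul I G)) (z, z) :=
      (contDiffAt_chartMul I).continuousAt_fderiv (by simp)
    have h2 : ContinuousAt (fun t => fderiv ℝ (chartMul I G) (y t, z)) 0 := by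
      refine ContinuousAt.comp (g := fderiv ℝ (chartMul I G)) (f := fun t => (y t, z)) ?_
        (hyc.prodMk continuousAt_const)
      simpa [hy0] using h1
    exact h2.clm_apply continuousAt_const
  have := hasStrictDerivAt_of_hasDerivAt_of_continuousAt hder hcd
  convert this using 1
  exact hd.unique hder.self_of_nhds

variable [CompleteSpace E]

/-- Every tangent vector at the identity is the velocity of a one-parameter subgroup. -/
theorem exists_isOneParam (X : E) : ∃ γ : ℝ → G, IsOneParam I γ X := by
  have : IsTopologicalGroup G := topologicalGroup_of_lieGroup I ∞
  have : T1Space G := I.t1Space G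
  have : LieGroup I (minSmoothness ℝ 3) G := by
    rw [minSmoothness_of_isRCLikeNormedField]; infer_instance
  let v : (g : G) → TangentSpace I g := mulInvariantVectorField (I := I) (G := G) X
  have hv : ContMDiff I I.tangent 1 (fun g : G => (⟨g, v g⟩ : TangentBundle I G)) :=
    (contMDiff_mulInvariantVectorField (I := I) (G := G) X).of_le (by simp)
  have hmd : ∀ g h : G, MDifferentiableAt I I (fun x : G => g * x) h := fun g h =>
    (contMDiff_mul_left (I := I) (n := ∞) (a := g)).mdifferentiableAt (by simp)
  have htr : ∀ g h : G, mfderiv I I (fun x : G => g * x) h (v h) = v (g * h) := by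
    intro g h
    have h1 : ∀ (k : G) (Y : E), k = h → (mfderiv I I (fun x : G => g * x) k : E → E) Y =
        (mfderiv I I (fun x : G => g * x) h : E → E) Y := by
      rintro k Y rfl; rfl
    have h2 := mfderiv_comp_apply (1 : G) (hmd g (h * 1)) (hmd h 1) X
    have h3 : (fun x : G => g * x) ∘ (fun x : G => h * x) = fun x => g * h * x := by
      ext x; simp [mul_assoc]
    rw [h3] at h2
    exact (h1 (h * 1) _ (mul_one h)).symm.trans h2.symm
  have hv1 : v 1 = X := by
    have h1 : (fun x : G => 1 * x) = id := by ext x; simp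
    change (mfderiv I I (fun x : G => 1 * x) 1 : E → E) X = X
    rw [h1, mfderiv_id]
    rfl
  obtain ⟨γ₀, h0, hγ₀⟩ :=
    exists_isMIntegralCurveAt_of_contMDiffAt_boundaryless 0 (hv.contMDiffAt (x := (1 : G)))
  rw [isMIntegralCurveAt_iff'] at hγ₀
  obtain ⟨ε, hε, hγ₀⟩ := hγ₀
  rw [Real.ball_eq_Ioo, zero_sub, zero_add] at hγ₀
  have hleft : ∀ (g : G) (γ : ℝ → G) (s : Set ℝ), IsMIntegralCurveOn γ v s →
      IsMIntegralCurveOn (fun t => g * γ t) v s := by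
    intro g γ s hγ t ht
    have := (hmd g (γ t)).hasMFDerivAt.comp_hasMFDerivWithinAt t (hγ t ht)
    refine this.congr_mfderiv ?_
    refine ContinuousLinearMap.ext fun c => ?_
    have h1 := htr g (γ t)
    have h2 := (mfderiv I I (fun x : G => g * x) (γ t)).map_smul c (v (γ t))
    rw [h1] at h2
    exact h2
  -- Left translates of one local solution pass through every point with the same lifetime `ε`, so
  -- the field is complete.
  obtain ⟨γ, hγ0, hγ⟩ := exists_isMIntegralCurve_of_isMIntegralCurveOn hv hε
    (fun g => ⟨fun t => g * γ₀ t, by simp [h0], hleft g _ _ hγ₀⟩) (1 : G)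
  refine ⟨γ, isOneParam_of_hasDerivAt I ?_ ?_ ?_⟩
  · intro s t
    have h1 : IsMIntegralCurve (fun t => γ s * γ t) v := by
      rw [isMIntegralCurve_iff_isMIntegralCurveOn]
      exact hleft _ _ _ (hγ.isMIntegralCurveOn _)
    have h2 := isMIntegralCurve_Ioo_eq_of_contMDiff_boundaryless (t₀ := 0) hv
      (hγ.comp_add s) h1 (by simp [hγ0])
    have := congrFun h2 t
    simpa [add_comm] using this
  · exact hγ.continuous
  · have h1 := (hγ.isMIntegralCurveAt 0).eventually_hasDerivAt.self_of_nhds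
    rw [hγ0] at h1
    have h2 := tangentCoordChange_self (I := I) (x := (1 : G)) (z := (1 : G)) (v := X)
      (mem_extChartAt_source (1 : G))
    rw [hv1, h2] at h1
    exact h1

end OneParameterExistence

/-! ### Generation by one-parameter subgroups, and limits of powers -/

section PowerComparison

open Filter Set

variable {E : Type*} [NormedAddCommGroup E] [NormedSpace ℝ E]
  {H : Type*} [TopologicalSpace H] (I : ModelWithCorners ℝ E H)
  {G : Type*} [TopologicalSpace G] [ChartedSpace H G] [Group G]
  [I.Boundaryless] [LieGroup I ∞ G]

/-- The one-parameter subgroups generate a connected Lie group. -/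
theorem closure_oneParam_eq_top [FiniteDimensional ℝ E] [ConnectedSpace G] :
    Subgroup.closure {g : G | ∃ (γ : ℝ → G) (X : E) (t : ℝ), IsOneParam I γ X ∧ γ t = g} = ⊤ := by
  have : IsTopologicalGroup G := topologicalGroup_of_lieGroup I ∞
  have : CompleteSpace E := FiniteDimensional.complete ℝ E
  set S : Set G := {g : G | ∃ (γ : ℝ → G) (X : E) (t : ℝ), IsOneParam I γ X ∧ γ t = g} with hS
  let b := Module.finBasis ℝ E
  choose γ hγ using fun i => exists_isOneParam I (G := G) (b i)
  -- Coordinates of the second kind: `Φ x` is the product of the `exp(x_i b_i)`. Over a full basis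
  -- its derivative at `0` is the identity.
  have key : ∀ l : List (Fin (Module.finrank ℝ E)), ∃ Φ : E → G, Continuous Φ ∧ Φ 0 = 1 ∧
      (∀ x, Φ x ∈ Subgroup.closure S) ∧
      HasStrictFDerivAt (fun x => extChartAt I (1 : G) (Φ x))
        (l.map fun i => (LinearMap.toContinuousLinearMap (b.coord i)).smulRight (b i)).sum 0 := by
    intro l
    induction l with
    | nil => exact ⟨fun _ => 1, continuous_const, rfl, fun _ => one_mem _,
        by simpa using hasStrictFDerivAt_const _ _⟩
    | cons i l ih =>
      obtain ⟨Φ, hc, h1, hmem, hd⟩ := ih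
      have hcoord : Continuous fun x => b.coord i x :=
        (LinearMap.toContinuousLinearMap (b.coord i)).continuous
      refine ⟨fun x => γ i (b.coord i x) * Φ x, ((hγ i).continuous.comp hcoord).mul hc, ?_, ?_, ?_⟩
      · simp [h1, (hγ i).map_zero]
      · exact fun x => mul_mem (Subgroup.subset_closure ⟨_, _, _, hγ i, rfl⟩) (hmem x)
      · rw [List.map_cons, List.sum_cons]
        refine hasStrictFDerivAt_extChartAt_mul I (((hγ i).continuous.comp hcoord).continuousAt)
          hc.continuousAt (by simp [(hγ i).map_zero]) h1 ?_ hd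
        have h2 : HasStrictDerivAt (fun t => extChartAt I (1 : G) (γ i t)) (b i)
            (LinearMap.toContinuousLinearMap (b.coord i) 0) := by
          simpa using (hγ i).hasStrictDerivAt
        have h3 := h2.hasStrictFDerivAt.comp (0 : E)
          (LinearMap.toContinuousLinearMap (b.coord i)).hasStrictFDerivAt
        refine h3.congr_fderiv ?_
        ext x
        simp
  obtain ⟨Φ, hc, h1, hmem, hd⟩ := key (List.finRange _)
  have hid : ((List.finRange (Module.finrank ℝ E)).map fun i =>
      (LinearMap.toContinuousLinearMap (b.coord i)).smulRight (b i)).sum =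
      ContinuousLinearMap.id ℝ E := by
    rw [← List.ofFn_eq_map, List.sum_ofFn]
    ext x
    simp
  rw [hid] at hd
  -- Thus `Φ` covers a neighbourhood of `1`, so the subgroup is open, hence closed, hence everything
  -- by connectedness.
  have hmap := hd.map_nhds_eq_of_surj (by simp)
  have hsrc : Φ ⁻¹' (extChartAt I (1 : G)).source ∈ 𝓝 (0 : E) :=
    hc.continuousAt.preimage_mem_nhds (by rw [h1]; exact extChartAt_source_mem_nhds (1 : G))
  have himg := image_mem_map (m := fun x => extChartAt I (1 : G) (Φ x)) hsrc
  rw [hmap, h1] at himg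
  have hnhds : (Subgroup.closure S : Set G) ∈ 𝓝 (1 : G) := by
    filter_upwards [(continuousAt_extChartAt (I := I) (1 : G)).preimage_mem_nhds himg,
      extChartAt_source_mem_nhds (I := I) (1 : G)] with g hg hgs
    obtain ⟨x, hx, hxg⟩ := hg
    have : Φ x = g := (extChartAt I (1 : G)).injOn hx hgs hxg
    exact this ▸ hmem x
  have hopen := Subgroup.isOpen_of_mem_nhds _ hnhds
  have hclopen : IsClopen (Subgroup.closure S : Set G) :=
    ⟨Subgroup.isClosed_of_isOpen _ hopen, hopen⟩
  exact SetLike.coe_injective (by simpa using hclopen.eq_univ ⟨1, one_mem _⟩)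

/-- The triple product is `C¹` in the chart, hence locally Lipschitz. This bounds the cost of
changing a single factor in a long product. -/
theorem exists_lipschitz_mul_mul :
    ∃ N ∈ 𝓝 (1 : G), ∃ C : ℝ, 0 < C ∧ ∀ x ∈ N, ∀ y ∈ N, ∀ a ∈ N, ∀ b ∈ N,
      ‖extChartAt I (1 : G) (x * a * y) - extChartAt I (1 : G) (x * b * y)‖ ≤
        C * ‖extChartAt I (1 : G) a - extChartAt I (1 : G) b‖ := by
  have : IsTopologicalGroup G := topologicalGroup_of_lieGroup I ∞
  set z := extChartAt I (1 : G) 1 with hz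
  let F : E × E × E → E := fun p => chartMul I G (chartMul I G (p.1, p.2.1), p.2.2)
  have hzz : chartMul I G (z, z) = z := by simp [chartMul, hz]
  have hF : ContDiffAt ℝ 1 F (z, z, z) := by
    have h0 : ContDiffAt ℝ 1 (chartMul I G) (z, z) := (contDiffAt_chartMul I).of_le (by simp)
    have h1 : ContDiffAt ℝ 1 (fun p : E × E × E => chartMul I G (p.1, p.2.1)) (z, z, z) :=
      ContDiffAt.comp (g := chartMul I G) (f := fun p : E × E × E => (p.1, p.2.1)) (z, z, z) h0
        (contDiff_fst.prodMk (contDiff_fst.comp contDiff_snd)).contDiffAt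
    refine ContDiffAt.comp (g := chartMul I G)
      (f := fun p : E × E × E => (chartMul I G (p.1, p.2.1), p.2.2)) (z, z, z) ?_
      (h1.prodMk (contDiff_snd.comp contDiff_snd).contDiffAt)
    simpa only [hzz] using h0
  obtain ⟨K, T, hT, hK⟩ := hF.exists_lipschitzOnWith
  have hcz : ContinuousAt (fun p : G × G × G =>
      (extChartAt I (1 : G) p.1, extChartAt I (1 : G) p.2.1, extChartAt I (1 : G) p.2.2))
      (1, 1, 1) := by
    have hc := continuousAt_extChartAt (I := I) (1 : G)
    refine ContinuousAt.prodMk ?_ (ContinuousAt.prodMk ?_ ?_)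
    · exact ContinuousAt.comp (g := extChartAt I (1 : G)) hc continuousAt_fst
    · exact ContinuousAt.comp (g := extChartAt I (1 : G)) (f := fun p : G × G × G => p.2.1) hc
        (by fun_prop)
    · exact ContinuousAt.comp (g := extChartAt I (1 : G)) (f := fun p : G × G × G => p.2.2) hc
        (by fun_prop)
  have hs : (extChartAt I (1 : G)).source ∈ 𝓝 (1 : G) := extChartAt_source_mem_nhds (1 : G)
  have hmul : ∀ᶠ p : G × G × G in 𝓝 (1, 1, 1), p.1 * p.2.1 ∈ (extChartAt I (1 : G)).source := by
    have : ContinuousAt (fun p : G × G × G => p.1 * p.2.1) (1, 1, 1) := by fun_prop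
    exact this.preimage_mem_nhds (by simpa using hs)
  have hall := inter_mem (hcz.preimage_mem_nhds hT) hmul
  obtain ⟨N₁, hN₁, M, hM, h1M⟩ := mem_nhds_prod_iff.1 hall
  obtain ⟨N₂, hN₂, N₃, hN₃, h23⟩ := mem_nhds_prod_iff.1 hM
  refine ⟨N₁ ∩ N₂ ∩ N₃ ∩ (extChartAt I (1 : G)).source,
    inter_mem (inter_mem (inter_mem hN₁ hN₂) hN₃) hs, K + 1, by positivity, ?_⟩
  intro x hx y hy a ha b hb
  have hFx : ∀ c ∈ N₁ ∩ N₂ ∩ N₃ ∩ (extChartAt I (1 : G)).source,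
      (extChartAt I (1 : G) x, extChartAt I (1 : G) c, extChartAt I (1 : G) y) ∈ T ∧
      extChartAt I (1 : G) (x * c * y) =
        F (extChartAt I (1 : G) x, extChartAt I (1 : G) c, extChartAt I (1 : G) y) := by
    intro c hc
    have h := h1M (mk_mem_prod hx.1.1.1 (h23 (mk_mem_prod hc.1.1.2 hy.1.2)))
    refine ⟨h.1, ?_⟩
    have h2 : x * c ∈ (extChartAt I (1 : G)).source := h.2
    simp only [F, chartMul, (extChartAt I (1 : G)).left_inv hx.2,
      (extChartAt I (1 : G)).left_inv hc.2, (extChartAt I (1 : G)).left_inv hy.2,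
      (extChartAt I (1 : G)).left_inv h2]
  obtain ⟨ha1, ha2⟩ := hFx a ha
  obtain ⟨hb1, hb2⟩ := hFx b hb
  rw [ha2, hb2]
  refine (hK.norm_sub_le ha1 hb1).trans ?_
  have : ‖(extChartAt I (1 : G) x, extChartAt I (1 : G) a, extChartAt I (1 : G) y) -
      (extChartAt I (1 : G) x, extChartAt I (1 : G) b, extChartAt I (1 : G) y)‖ =
      ‖extChartAt I (1 : G) a - extChartAt I (1 : G) b‖ := by
    simp [Prod.norm_def]
  rw [this]
  gcongr
  linarith

/-- If `a` is a curve through the identity with the same velocity as the one-parameter subgroup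
`γ`, then `a (t / n) ^ n` tends to `γ t`. -/
theorem IsOneParam.exists_tendsto_pow {γ a : ℝ → G} {X : E} (hγ : IsOneParam I γ X)
    (ha : ContinuousAt a 0) (ha1 : a 0 = 1)
    (hA : HasStrictDerivAt (fun t => extChartAt I (1 : G) (a t)) X 0) :
    ∃ t₀ > 0, ∀ t, |t| ≤ t₀ → Tendsto (fun n : ℕ => a (t / n) ^ n) atTop (𝓝 (γ t)) := by
  have : IsTopologicalGroup G := topologicalGroup_of_lieGroup I ∞
  obtain ⟨N, hN, C, hC, hLip⟩ := exists_lipschitz_mul_mul I (G := G)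
  set κ := extChartAt I (1 : G) with hκ
  have hs : κ.source ∈ 𝓝 (1 : G) := extChartAt_source_mem_nhds (1 : G)
  -- `V` guarantees that the next power of `a (t / n)` is still in the chart domain before its
  -- distance to `1` is estimated.
  obtain ⟨V, hV, hVmul⟩ := exists_nhds_one_split (inter_mem hN hs)
  have hVN : V ∩ (N ∩ κ.source) ∈ 𝓝 (1 : G) := inter_mem hV (inter_mem hN hs)
  -- One `r` is for the distance of `γ s` from `1`, the other for the accumulated error.
  obtain ⟨r, hr, hball⟩ : ∃ r > 0, ∀ g ∈ κ.source, ‖κ g - κ 1‖ < 2 * r →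
      g ∈ V ∩ (N ∩ κ.source) := by
    have h1 : ContinuousAt κ.symm (κ 1) := continuousAt_extChartAt_symm (1 : G)
    have h2 := h1.preimage_mem_nhds (t := V ∩ (N ∩ κ.source))
      (by rw [hκ, extChartAt_to_inv]; exact hVN)
    obtain ⟨ρ, hρ, hρb⟩ := Metric.mem_nhds_iff.1 h2
    refine ⟨ρ / 2, half_pos hρ, fun g hg hgr => ?_⟩
    have h3 : κ g ∈ Metric.ball (κ 1) ρ := by rw [mem_ball_iff_norm]; linarith
    have h4 := hρb h3
    rwa [mem_preimage, κ.left_inv hg] at h4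
  have hγn : ∀ᶠ s in 𝓝 (0 : ℝ), γ s ∈ V ∩ (N ∩ κ.source) ∧ ‖κ (γ s) - κ 1‖ < r := by
    refine Eventually.and (hγ.continuous.continuousAt.preimage_mem_nhds
      (by rw [hγ.map_zero]; exact hVN)) ?_
    have h1 : ContinuousAt (fun s => ‖κ (γ s) - κ 1‖) 0 :=
      (hγ.hasStrictDerivAt.hasDerivAt.continuousAt.sub continuousAt_const).norm
    exact h1.eventually_lt continuousAt_const (by simpa [hγ.map_zero] using hr)
  obtain ⟨t₁, ht₁, hγt₁⟩ := Metric.eventually_nhds_iff.1 hγn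
  refine ⟨t₁ / 2, half_pos ht₁, fun t ht => ?_⟩
  have hγs : ∀ s, |s| ≤ |t| → γ s ∈ V ∩ (N ∩ κ.source) ∧ ‖κ (γ s) - κ 1‖ < r := fun s hst =>
    hγt₁ (by rw [Real.dist_eq, sub_zero]; linarith)
  have hdiv : Tendsto (fun n : ℕ => t / n) atTop (𝓝 0) := tendsto_const_div_atTop_nhds_zero_nat t
  -- Equal velocities make the difference `o(s)` at `s = t / n`, which absorbs the factor `n`.
  have hlim : Tendsto (fun n : ℕ => n * ‖κ (a (t / n)) - κ (γ (t / n))‖) atTop (𝓝 0) := by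
    have h1 := (hA.hasDerivAt.sub hγ.hasStrictDerivAt.hasDerivAt).isLittleO
    simp only [ha1, hγ.map_zero, ← hκ, Pi.sub_apply] at h1
    simp only [sub_self, smul_zero, sub_zero] at h1
    have h2 := (h1.comp_tendsto hdiv).norm_left
    have h3 := (Asymptotics.isBigO_refl (fun n : ℕ => (n : ℝ)) atTop).mul_isLittleO h2
    have h4 : (fun n : ℕ => (n : ℝ) * ((fun x' : ℝ => x') ∘ fun n : ℕ => t / n) n) =O[atTop]
        fun _ => (1 : ℝ) := by
      refine Asymptotics.IsBigO.of_bound |t| ?_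
      filter_upwards [eventually_gt_atTop 0] with n hn
      have : (n : ℝ) ≠ 0 := by positivity
      simp [mul_div_cancel₀ _ this]
    exact (Asymptotics.isLittleO_one_iff ℝ).1 (h3.trans_isBigO h4)
  have hev : ∀ᶠ n : ℕ in atTop, 0 < n ∧ a (t / n) ∈ V ∩ (N ∩ κ.source) ∧
      C * (n * ‖κ (a (t / n)) - κ (γ (t / n))‖) < r := by
    refine (eventually_gt_atTop 0).and (Eventually.and ?_ ?_)
    · exact hdiv.eventually (ha.preimage_mem_nhds (by rw [ha1]; exact hVN))
    · have := hlim.const_mul C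
      rw [mul_zero] at this
      exact this.eventually (gt_mem_nhds hr)
  have hpow : ∀ᶠ n : ℕ in atTop, a (t / n) ^ n ∈ κ.source ∧
      ‖κ (a (t / n) ^ n) - κ (γ t)‖ ≤ C * (n * ‖κ (a (t / n)) - κ (γ (t / n))‖) := by
    filter_upwards [hev] with n hn
    obtain ⟨hn0, han, hCn⟩ := hn
    have hn0' : (0 : ℝ) < n := by exact_mod_cast hn0
    set b := γ (t / n)
    set δ := ‖κ (a (t / n)) - κ b‖
    have hδ : 0 ≤ δ := norm_nonneg _
    have hb : ∀ k : ℕ, k ≤ n → b ^ k ∈ V ∩ (N ∩ κ.source) ∧ ‖κ (b ^ k) - κ 1‖ < r := by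
      intro k hk
      rw [← hγ.map_nsmul]
      refine hγs _ ?_
      have hkn : (k : ℝ) ≤ n := by exact_mod_cast hk
      rw [abs_mul, abs_div, Nat.abs_cast, Nat.abs_cast, mul_div_assoc', div_le_iff₀ hn0', mul_comm]
      gcongr
    -- Telescoping: the factors `b` are replaced by `a (t / n)` one at a time, each at cost `C * δ`.
    -- The same induction keeps the powers where `hLip` applies.
    have hind : ∀ i : ℕ, i ≤ n → a (t / n) ^ i ∈ V ∩ (N ∩ κ.source) ∧
        ∀ k, i + k ≤ n → ‖κ (a (t / n) ^ i * b ^ k) - κ (b ^ (i + k))‖ ≤ C * (i * δ) := by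
      intro i
      induction i with
      | zero => exact fun _ => ⟨by simpa using (hb 0 (Nat.zero_le _)).1, by simp⟩
      | succ i ih =>
        intro hi
        obtain ⟨hmem, hbd⟩ := ih (by omega)
        have hstep : ∀ k, i + 1 + k ≤ n →
            ‖κ (a (t / n) ^ (i + 1) * b ^ k) - κ (b ^ (i + 1 + k))‖ ≤
              C * ((i + 1 : ℕ) * δ) := by
          intro k hk
          have h1 := hLip _ hmem.2.1 _ (hb k (by omega)).1.2.1 _ han.2.1 b
            (by simpa using (hb 1 (by omega)).1.2.1)
          have h2 := hbd (k + 1) (by omega)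
          rw [← pow_succ, mul_assoc, ← pow_succ'] at h1
          have h3 : i + 1 + k = i + (k + 1) := by ring
          rw [h3]
          calc _ ≤ _ := norm_sub_le_norm_sub_add_norm_sub _ (κ (a (t / n) ^ i * b ^ (k + 1))) _
            _ ≤ C * δ + C * (i * δ) := add_le_add h1 h2
            _ = _ := by push_cast; ring
        refine ⟨?_, hstep⟩
        have h4 : a (t / n) ^ (i + 1) ∈ κ.source := by
          rw [pow_succ]; exact (hVmul _ hmem.1 _ han.1).2
        refine hball _ h4 ?_
        have h5 := hstep 0 (by omega)
        rw [pow_zero, mul_one, add_zero] at h5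
        have h6 := (hb (i + 1) hi).2
        have h7 : C * ((i + 1 : ℕ) * δ) ≤ C * (n * δ) := by gcongr
        have h8 := norm_sub_le_norm_sub_add_norm_sub (κ (a (t / n) ^ (i + 1)))
          (κ (b ^ (i + 1))) (κ 1)
        linarith
    obtain ⟨h1, h2⟩ := hind n le_rfl
    refine ⟨h1.2.2, ?_⟩
    have h3 := h2 0 (by omega)
    rw [pow_zero, mul_one, add_zero, ← hγ.map_nsmul, mul_div_cancel₀ _ hn0'.ne'] at h3
    exact h3
  have hκlim : Tendsto (fun n : ℕ => κ (a (t / n) ^ n)) atTop (𝓝 (κ (γ t))) := by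
    rw [tendsto_iff_norm_sub_tendsto_zero]
    have := hlim.const_mul C
    rw [mul_zero] at this
    exact squeeze_zero' (Eventually.of_forall fun _ => norm_nonneg _)
      (hpow.mono fun n hn => hn.2) this
  have hγt : γ t ∈ κ.source := (hγs t le_rfl).1.2.2
  have hsymm := (continuousAt_extChartAt_symm' hγt).tendsto.comp hκlim
  rw [κ.left_inv hγt] at hsymm
  refine hsymm.congr' ?_
  filter_upwards [hpow] with n hn
  exact κ.left_inv hn.1

end PowerComparison

/-! ### Lie algebras of closed subgroups -/

section ClosedSubgroups

open Filter Set
open scoped commutatorElement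

variable {E : Type*} [NormedAddCommGroup E] [NormedSpace ℝ E]
  {H : Type*} [TopologicalSpace H] (I : ModelWithCorners ℝ E H)
  {G : Type*} [TopologicalSpace G] [ChartedSpace H G] [Group G]
  [I.Boundaryless] [LieGroup I ∞ G]

theorem exists_pos_natCast_abs_div_le (t : ℝ) {t₀ : ℝ} (ht₀ : 0 < t₀) :
    ∃ n : ℕ, 0 < n ∧ |t / n| ≤ t₀ := by
  obtain ⟨n, hn⟩ := exists_nat_gt (|t| / t₀)
  have hn0 : (0 : ℝ) < n := lt_of_le_of_lt (by positivity) hn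
  refine ⟨n, by exact_mod_cast hn0, ?_⟩
  rw [abs_div, Nat.abs_cast, div_le_iff₀ hn0]
  rw [div_lt_iff₀ ht₀] at hn
  linarith

namespace IsOneParam

variable {I} {γ a : ℝ → G} {X : E}

/-- A homomorphism sending a curve `a` to a one-parameter subgroup `f` sends the one-parameter
subgroup with the velocity of `a` to `f`. -/
theorem map_eq_of_map_curve_eq {K : Type*} [Group K] [TopologicalSpace K] [T2Space K]
    (hγ : IsOneParam I γ X) (ha : ContinuousAt a 0) (ha1 : a 0 = 1)
    (hA : HasStrictDerivAt (fun t => extChartAt I (1 : G) (a t)) X 0)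
    (π : G →* K) (hπ : Continuous π) {f : ℝ → K} (hf : ∀ (n : ℕ) t, f (n * t) = f t ^ n)
    (haf : ∀ t, π (a t) = f t) (t : ℝ) : π (γ t) = f t := by
  obtain ⟨t₀, ht₀, hlim⟩ := hγ.exists_tendsto_pow I ha ha1 hA
  -- The images of `a (s / n) ^ n` are all equal to `f s` for `n > 0`, so their limit is too.
  have hsmall : ∀ s, |s| ≤ t₀ → π (γ s) = f s := by
    intro s hs
    have h1 := (hπ.tendsto _).comp (hlim s hs)
    refine tendsto_nhds_unique h1 (tendsto_const_nhds.congr' ?_)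
    filter_upwards [eventually_gt_atTop 0] with n hn
    have hn' : (n : ℝ) ≠ 0 := by positivity
    simp only [Function.comp_apply, map_pow, haf, ← hf, mul_div_cancel₀ _ hn']
  obtain ⟨n, hn, hnt⟩ := exists_pos_natCast_abs_div_le t ht₀
  have hn' : (n : ℝ) ≠ 0 := by positivity
  rw [← mul_div_cancel₀ t hn', hγ.map_nsmul, map_pow, hsmall _ hnt, hf]

/-- If a curve stays in a closed subgroup, so does the one-parameter subgroup with the same
velocity. -/
theorem mem_of_curve_mem (hγ : IsOneParam I γ X) (ha : ContinuousAt a 0) (ha1 : a 0 = 1)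
    (hA : HasStrictDerivAt (fun t => extChartAt I (1 : G) (a t)) X 0)
    {B : Subgroup G} (hB : IsClosed (B : Set G)) (haB : ∀ t, a t ∈ B) (t : ℝ) : γ t ∈ B := by
  obtain ⟨t₀, ht₀, hlim⟩ := hγ.exists_tendsto_pow I ha ha1 hA
  obtain ⟨n, hn, hnt⟩ := exists_pos_natCast_abs_div_le t ht₀
  have hn' : (n : ℝ) ≠ 0 := by positivity
  rw [← mul_div_cancel₀ t hn', hγ.map_nsmul]
  exact pow_mem (hB.mem_of_tendsto (hlim _ hnt) (Eventually.of_forall fun k => pow_mem (haB _) k)) n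

theorem unique [T2Space G] {γ' : ℝ → G} (hγ : IsOneParam I γ X) (hγ' : IsOneParam I γ' X) :
    γ = γ' :=
  funext fun t => hγ.map_eq_of_map_curve_eq hγ'.continuous.continuousAt hγ'.map_zero
    hγ'.hasStrictDerivAt (MonoidHom.id G) continuous_id hγ'.map_nsmul (fun _ => rfl) t

end IsOneParam

variable [CompleteSpace E]

variable (G) in
/-- The one-parameter subgroup `t ↦ exp (t X)`. -/
noncomputable def oneParam (X : E) : ℝ → G := (exists_isOneParam I X).choose

theorem isOneParam_oneParam (X : E) : IsOneParam I (oneParam I G X) X :=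
  (exists_isOneParam I X).choose_spec

theorem oneParam_smul [T2Space G] (c : ℝ) (X : E) (t : ℝ) :
    oneParam I G (c • X) t = oneParam I G X (c * t) :=
  congrFun ((isOneParam_oneParam I (c • X)).unique ((isOneParam_oneParam I X).comp_mul c)) t

theorem map_oneParam [T2Space G] (f : G →* G) (hf : ContMDiff I I ∞ f) (X : E) (t : ℝ) :
    f (oneParam I G X t) = oneParam I G (derivAtOne I f X) t :=
  congrFun (((isOneParam_oneParam I X).map f hf).unique (isOneParam_oneParam I _)) t

theorem exists_conj_oneParam [T2Space G] (g : G) (X : E) :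
    ∃ Y : E, ∀ t, g * oneParam I G X t * g⁻¹ = oneParam I G Y t :=
  ⟨_, map_oneParam I (MulAut.conj g).toMonoidHom
    ((contMDiff_mul_right (a := g⁻¹)).comp (contMDiff_mul_left (a := g))) X⟩

/-- The curve `t ↦ exp (t X) exp (t Y)` has velocity `X + Y`. -/
theorem hasStrictDerivAt_oneParam_mul (X Y : E) :
    HasStrictDerivAt (fun t => extChartAt I (1 : G) (oneParam I G X t * oneParam I G Y t))
      (X + Y) 0 :=
  hasStrictDerivAt_extChartAt_mul I (isOneParam_oneParam I X).continuous.continuousAt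
    (isOneParam_oneParam I Y).continuous.continuousAt (isOneParam_oneParam I X).map_zero
    (isOneParam_oneParam I Y).map_zero (isOneParam_oneParam I X).hasStrictDerivAt
    (isOneParam_oneParam I Y).hasStrictDerivAt

theorem oneParam_mul_continuousAt (X Y : E) :
    ContinuousAt (fun t => oneParam I G X t * oneParam I G Y t) 0 :=
  have : IsTopologicalGroup G := topologicalGroup_of_lieGroup I ∞
  ((isOneParam_oneParam I X).continuous.mul (isOneParam_oneParam I Y).continuous).continuousAt

theorem oneParam_mul_zero (X Y : E) : oneParam I G X 0 * oneParam I G Y 0 = 1 := by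
  rw [(isOneParam_oneParam I X).map_zero, (isOneParam_oneParam I Y).map_zero, one_mul]

/-- The Lie algebra of a closed subgroup, as a subspace of the model space. -/
noncomputable def lieSubmodule [T2Space G] (A : Subgroup G) (hA : IsClosed (A : Set G)) :
    Submodule ℝ E where
  carrier := {X | ∀ t, oneParam I G X t ∈ A}
  zero_mem' t := by
    have := oneParam_smul I (G := G) 0 0 t
    rw [zero_smul, zero_mul, (isOneParam_oneParam I 0).map_zero] at this
    exact this ▸ one_mem A
  add_mem' {X Y} hX hY := (isOneParam_oneParam I (X + Y)).mem_of_curve_mem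
    (oneParam_mul_continuousAt I X Y) (oneParam_mul_zero I X Y)
    (hasStrictDerivAt_oneParam_mul I X Y) hA fun t => mul_mem (hX t) (hY t)
  smul_mem' c X hX t := by rw [oneParam_smul]; exact hX _

variable [T2Space G]

/-- If two one-parameter subgroups differ infinitesimally by an element of the Lie algebra of a
closed normal subgroup `B`, they agree modulo `B`. -/
theorem mk_oneParam_eq_of_sub_mem (B : Subgroup G) [B.Normal] (hB : IsClosed (B : Set G))
    {X Y : E} (h : Y - X ∈ lieSubmodule I B hB) (t : ℝ) :
    (oneParam I G Y t : G ⧸ B) = oneParam I G X t := by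
  have : IsTopologicalGroup G := topologicalGroup_of_lieGroup I ∞
  have := hB
  -- The curve `exp(tX) exp(t(Y - X))` has velocity `Y` and coincides with `exp(tX)` modulo `B`.
  have hd := hasStrictDerivAt_oneParam_mul I (G := G) X (Y - X)
  rw [add_sub_cancel] at hd
  refine (isOneParam_oneParam I Y).map_eq_of_map_curve_eq (oneParam_mul_continuousAt I X (Y - X))
    (oneParam_mul_zero I X (Y - X)) hd (QuotientGroup.mk' B) QuotientGroup.continuous_mk
    (f := fun t => (oneParam I G X t : G ⧸ B)) ?_ ?_ t
  · intro n t
    rw [(isOneParam_oneParam I X).map_nsmul]; rfl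
  · intro t
    simp [(QuotientGroup.eq_one_iff _).2 (h t)]

/-- Modulo a closed normal subgroup containing the commutators of `A`, the exponential is additive
on the Lie algebra of `A`. -/
theorem mk_oneParam_add (A B : Subgroup G) [B.Normal] (hA : IsClosed (A : Set G))
    (hB : IsClosed (B : Set G)) (hAB : ⁅A, A⁆ ≤ B) {X Y : E}
    (hX : X ∈ lieSubmodule I A hA) (hY : Y ∈ lieSubmodule I A hA) (t : ℝ) :
    (oneParam I G (X + Y) t : G ⧸ B) = oneParam I G X t * oneParam I G Y t := by
  have : IsTopologicalGroup G := topologicalGroup_of_lieGroup I ∞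
  have := hB
  refine (isOneParam_oneParam I (X + Y)).map_eq_of_map_curve_eq (oneParam_mul_continuousAt I X Y)
    (oneParam_mul_zero I X Y) (hasStrictDerivAt_oneParam_mul I X Y) (QuotientGroup.mk' B)
    QuotientGroup.continuous_mk
    (f := fun t => (oneParam I G X t : G ⧸ B) * oneParam I G Y t) ?_ ?_ t
  · intro n t
    have hcomm : Commute (oneParam I G X t : G ⧸ B) (oneParam I G Y t) := by
      have h1 : ⁅oneParam I G X t, oneParam I G Y t⁆ ∈ B :=
        hAB (Subgroup.commutator_mem_commutator (hX t) (hY t))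
      rw [← QuotientGroup.eq_one_iff] at h1
      exact commutatorElement_eq_one_iff_commute.1 h1
    rw [hcomm.mul_pow, (isOneParam_oneParam I X).map_nsmul, (isOneParam_oneParam I Y).map_nsmul]
    rfl
  · intro t
    simp

/-- The subgroup generated by the one-parameter subgroups contained in `A`. -/
def oneParamClosure (A : Subgroup G) : Subgroup G :=
  Subgroup.closure {g | ∃ X : E, (∀ t, oneParam I G X t ∈ A) ∧ ∃ t, oneParam I G X t = g}

theorem oneParamClosure_top [FiniteDimensional ℝ E] [ConnectedSpace G] :
    oneParamClosure I (⊤ : Subgroup G) = ⊤ := by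
  refine eq_top_iff.2 ((closure_oneParam_eq_top I (G := G)).ge.trans (Subgroup.closure_mono ?_))
  rintro g ⟨γ, X, t, hγ, rfl⟩
  exact ⟨X, fun _ => trivial, t, congrFun ((isOneParam_oneParam I X).unique hγ) t⟩

instance oneParamClosure_normal (A : Subgroup G) [hA : A.Normal] :
    (oneParamClosure I A).Normal := by
  refine ⟨fun n hn g => ?_⟩
  induction hn using Subgroup.closure_induction with
  | mem x hx =>
    obtain ⟨X, hX, t, rfl⟩ := hx
    obtain ⟨Y, hY⟩ := exists_conj_oneParam I g X
    exact Subgroup.subset_closure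
      ⟨Y, fun s => hY s ▸ hA.conj_mem _ (hX s) g, t, (hY t).symm⟩
  | one => simp
  | mul x y _ _ hx hy => simpa [mul_assoc] using mul_mem hx hy
  | inv x _ hx => simpa [mul_assoc] using inv_mem hx

/-- If a normal subgroup is topologically generated by one-parameter subgroups, so is the
closure of its commutator subgroup. -/
theorem topologicalClosure_commutator_le [IsTopologicalGroup G] (A : Subgroup G) [A.Normal]
    (hgen : A ≤ (oneParamClosure I A).topologicalClosure) :
    ⁅A, A⁆.topologicalClosure ≤
      (oneParamClosure I ⁅A, A⁆.topologicalClosure).topologicalClosure := by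
  set B := ⁅A, A⁆.topologicalClosure with hBdef
  have hBc : IsClosed (B : Set G) := Subgroup.isClosed_topologicalClosure _
  have hBn : B.Normal := Subgroup.is_normal_topologicalClosure _
  set B' := (oneParamClosure I B).topologicalClosure with hB'
  have hB'c : IsClosed (B' : Set G) := Subgroup.isClosed_topologicalClosure _
  have hB'n : B'.Normal := Subgroup.is_normal_topologicalClosure _
  have hsub : ∀ X, X ∈ lieSubmodule I B hBc → X ∈ lieSubmodule I B' hB'c := fun X hX t =>
    Subgroup.le_topologicalClosure _ (Subgroup.subset_closure ⟨X, hX, t, rfl⟩)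
  refine Subgroup.topologicalClosure_minimal _ (Subgroup.commutator_le.2 fun g hg h hh => ?_) hB'c
  -- `Z` is the centralizer of `g` modulo `B'`. Being closed, it contains `A` once it contains the
  -- one-parameter subgroups of `A`.
  let Z : Subgroup G := (Subgroup.centralizer {(g : G ⧸ B')}).comap (QuotientGroup.mk' B')
  have hZmem : ∀ x, x ∈ Z ↔ ⁅g, x⁆ ∈ B' := by
    intro x
    rw [← QuotientGroup.eq_one_iff (N := B')]
    change (x : G ⧸ B') ∈ Subgroup.centralizer {(g : G ⧸ B')} ↔ ⁅(g : G ⧸ B'), (x : G ⧸ B')⁆ = 1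
    rw [Subgroup.mem_centralizer_singleton_iff, commutatorElement_eq_one_iff_mul_comm]
    exact eq_comm
  have hZc : IsClosed (Z : Set G) := by
    have : (Z : Set G) = (fun x => ⁅g, x⁆) ⁻¹' B' := by ext x; exact hZmem x
    rw [this]
    refine hB'c.preimage ?_
    simp only [commutatorElement_def]
    fun_prop
  have hle : (oneParamClosure I A).topologicalClosure ≤ Z := by
    refine Subgroup.topologicalClosure_minimal _ ((Subgroup.closure_le _).2 ?_) hZc
    rintro x ⟨X, hX, t, rfl⟩
    obtain ⟨Y, hY⟩ := exists_conj_oneParam I g X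
    -- The curve `exp(sY) exp(-sX)` is the commutator of `g` and `exp(sX)`, so it stays in `B`, and
    -- its velocity `Y - X` is tangent to `B`.
    have hYX : Y - X ∈ lieSubmodule I B hBc := by
      have hd := hasStrictDerivAt_oneParam_mul I (G := G) Y (-X)
      rw [← sub_eq_add_neg] at hd
      refine (isOneParam_oneParam I (Y - X)).mem_of_curve_mem (oneParam_mul_continuousAt I Y (-X))
        (oneParam_mul_zero I Y (-X)) hd hBc fun s => ?_
      have h1 : oneParam I G (-X) s = (oneParam I G X s)⁻¹ := by
        rw [← neg_one_smul ℝ X, oneParam_smul, neg_one_mul, (isOneParam_oneParam I X).map_neg]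
      rw [h1, ← hY]
      exact Subgroup.le_topologicalClosure _ (Subgroup.commutator_mem_commutator hg (hX s))
    have h2 := mk_oneParam_eq_of_sub_mem I B' hB'c (hsub _ hYX) t
    rw [← hY] at h2
    rw [SetLike.mem_coe, hZmem, commutatorElement_def, ← QuotientGroup.eq_one_iff]
    rw [QuotientGroup.mk_mul, h2, ← QuotientGroup.mk_mul, mul_inv_cancel, QuotientGroup.mk_one]
  exact (hZmem h).1 (hle (hgen hh))

end ClosedSubgroups

/-! ### The closed derived series -/

section ClosedDerivedSeries

open Filter Set
open scoped commutatorElement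

variable (G : Type*) [Group G] [TopologicalSpace G] [IsTopologicalGroup G]

/-- The closed derived series of a topological group. -/
def closedDerivedSeries : ℕ → Subgroup G
  | 0 => ⊤
  | n + 1 => ⁅closedDerivedSeries n, closedDerivedSeries n⁆.topologicalClosure

theorem isClosed_closedDerivedSeries (n : ℕ) : IsClosed (closedDerivedSeries G n : Set G) := by
  cases n with
  | zero => exact isClosed_univ
  | succ n => exact Subgroup.isClosed_topologicalClosure _

instance closedDerivedSeries_normal (n : ℕ) : (closedDerivedSeries G n).Normal := by
  induction n with
  | zero => exact inferInstanceAs (⊤ : Subgroup G).Normal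
  | succ n ih => exact Subgroup.is_normal_topologicalClosure _

variable {G}

theorem commutator_topologicalClosure_le (A : Subgroup G) :
    ⁅A.topologicalClosure, A.topologicalClosure⁆ ≤ ⁅A, A⁆.topologicalClosure := by
  refine Subgroup.commutator_le.2 fun g hg h hh => ?_
  refine map_mem_closure₂ (f := fun x y : G => ⁅x, y⁆) ?_ hg hh
    fun x hx y hy => Subgroup.commutator_mem_commutator hx hy
  simp only [commutatorElement_def]
  fun_prop

/-- Commutators are continuous, so closing at every stage gains nothing over closing once at the
end. This is why the closed series of a solvable group terminates. -/
theorem closedDerivedSeries_le (n : ℕ) :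
    closedDerivedSeries G n ≤ (derivedSeries G n).topologicalClosure := by
  induction n with
  | zero => exact Subgroup.le_topologicalClosure _
  | succ n ih =>
    refine Subgroup.topologicalClosure_minimal _ ?_ (Subgroup.isClosed_topologicalClosure _)
    exact (Subgroup.commutator_mono ih ih).trans (commutator_topologicalClosure_le _)

theorem exists_closedDerivedSeries_eq_bot [T1Space G] [hs : Group.IsSolvable G] :
    ∃ n, closedDerivedSeries G n = ⊥ := by
  obtain ⟨n, hn⟩ := hs.solvable
  refine ⟨n, le_bot_iff.1 ((closedDerivedSeries_le n).trans ?_)⟩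
  rw [hn]
  exact Subgroup.topologicalClosure_minimal _ le_rfl (by simp)

/-- A continuous endomorphism preserves the closed derived series. -/
theorem map_mem_closedDerivedSeries (f : G →* G) (hf : Continuous f) (n : ℕ) :
    ∀ g ∈ closedDerivedSeries G n, f g ∈ closedDerivedSeries G n := by
  induction n with
  | zero => exact fun _ _ => trivial
  | succ n ih =>
    intro g hg
    have hle : ⁅closedDerivedSeries G n, closedDerivedSeries G n⁆ ≤
        (closedDerivedSeries G (n + 1)).comap f := by
      refine Subgroup.commutator_le.2 fun x hx y hy => ?_
      rw [Subgroup.mem_comap, map_commutatorElement]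
      exact Subgroup.le_topologicalClosure _
        (Subgroup.commutator_mem_commutator (ih x hx) (ih y hy))
    exact Subgroup.topologicalClosure_minimal _ hle
      ((isClosed_closedDerivedSeries G (n + 1)).preimage hf) hg

theorem closedDerivedSeries_le_oneParamClosure
    {E : Type*} [NormedAddCommGroup E] [NormedSpace ℝ E] [FiniteDimensional ℝ E] [CompleteSpace E]
    {H : Type*} [TopologicalSpace H] (I : ModelWithCorners ℝ E H) [I.Boundaryless]
    [ChartedSpace H G] [LieGroup I ∞ G] [T2Space G] [ConnectedSpace G] (n : ℕ) :
    closedDerivedSeries G n ≤ (oneParamClosure I (closedDerivedSeries G n)).topologicalClosure := by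
  induction n with
  | zero => exact (oneParamClosure_top I).ge.trans (Subgroup.le_topologicalClosure _)
  | succ n ih =>
    exact topologicalClosure_commutator_le I _ ih

end ClosedDerivedSeries

/-! ### Products of moved small elements in time windows -/

section Windows

open Filter Set

variable {G : Type*} [Group G]

/-- `FlowProduct φ U τ a b g`: `g` is a product `φ_{S₁}(u₁) ⋯ φ_{Sₙ}(uₙ)` with `uᵢ ∈ U` and times
`S₁ > ⋯ > Sₙ` in `[a + τ, b - τ]` at distance at least `2 τ` from each other. -/
inductive FlowProduct (φ : ℝ → G →* G) (U : Set G) (τ : ℝ) : ℝ → ℝ → G → Prop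
  | single {a b S : ℝ} {u : G} (ha : a + τ ≤ S) (hb : S + τ ≤ b) (hu : u ∈ U) :
      FlowProduct φ U τ a b (φ S u)
  | mul {a b c : ℝ} {g h : G} (hg : FlowProduct φ U τ b c g) (hh : FlowProduct φ U τ a b h) :
      FlowProduct φ U τ a c (g * h)

namespace FlowProduct

variable {φ : ℝ → G →* G} {U : Set G} {τ : ℝ}

theorem mono {a b a' b' : ℝ} {g : G} (h : FlowProduct φ U τ a b g) (ha : a' ≤ a) (hb : b ≤ b') :
    FlowProduct φ U τ a' b' g := by
  induction h generalizing a' b' with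
  | single h1 h2 hu => exact single (by linarith) (by linarith) hu
  | mul _ _ ih1 ih2 => exact mul (ih1 le_rfl hb) (ih2 ha le_rfl)

theorem one (hU : (1 : G) ∈ U) (a : ℝ) : FlowProduct φ U τ a (a + 2 * τ) 1 := by
  have := single (φ := φ) (τ := τ) (a := a) (b := a + 2 * τ) (S := a + τ) le_rfl (by linarith) hU
  rwa [map_one] at this

/-- It suffices to vary the leftmost factor: `φ_S(U)` is open and right translation by the other
factors is a homeomorphism. -/
theorem eventually [TopologicalSpace G] [IsTopologicalGroup G] (hU : IsOpen U)
    (hφc : ∀ t, Continuous (φ t)) (hinv : ∀ t g, φ t (φ (-t) g) = g) {a b : ℝ} {g : G}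
    (h : FlowProduct φ U τ a b g) : ∀ᶠ x in 𝓝 g, FlowProduct φ U τ a b x := by
  induction h with
  | @single a b S u h1 h2 hu =>
    have h3 : φ (-S) (φ S u) = u := by simpa using hinv (-S) u
    have h4 : ∀ᶠ x in 𝓝 (φ S u), φ (-S) x ∈ U :=
      (hφc (-S)).continuousAt.preimage_mem_nhds (by rw [h3]; exact hU.mem_nhds hu)
    filter_upwards [h4] with x hx
    have := single (φ := φ) h1 h2 hx
    rwa [hinv] at this
  | @mul a b c g h hg hh ih1 ih2 =>
    have h1 : Tendsto (fun x => x * h⁻¹) (𝓝 (g * h)) (𝓝 g) := by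
      have : ContinuousAt (fun x => x * h⁻¹) (g * h) := by fun_prop
      simpa [ContinuousAt] using this
    filter_upwards [h1.eventually ih1] with x hx
    simpa using mul hx hh

/-- The elements which, modulo `B`, are flow products with arbitrarily late times. -/
def lateProducts (φ : ℝ → G →* G) (U : Set G) (τ : ℝ) (B : Subgroup G) : Set G :=
  {y | ∀ a, ∃ b w, FlowProduct φ U τ a b w ∧ (w : G ⧸ B) = y}

theorem mul_mem_lateProducts (B : Subgroup G) [B.Normal] {x y : G}
    (hx : x ∈ lateProducts φ U τ B) (hy : y ∈ lateProducts φ U τ B) :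
    x * y ∈ lateProducts φ U τ B := by
  intro a
  obtain ⟨b, w, hw, hwy⟩ := hy a
  obtain ⟨c, w', hw', hwx⟩ := hx b
  exact ⟨c, w' * w, mul hw' hw, by simp [hwx, hwy]⟩

theorem one_mem_lateProducts (B : Subgroup G) (hU : (1 : G) ∈ U) :
    (1 : G) ∈ lateProducts φ U τ B :=
  fun a => ⟨_, 1, one hU a, rfl⟩

theorem pow_mem_lateProducts (B : Subgroup G) [B.Normal] (hU : (1 : G) ∈ U) {x : G}
    (hx : x ∈ lateProducts φ U τ B) (n : ℕ) : x ^ n ∈ lateProducts φ U τ B := by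
  induction n with
  | zero => simpa using one_mem_lateProducts B hU
  | succ n ih => rw [pow_succ]; exact mul_mem_lateProducts B ih hx

/-- If every element is a flow product modulo `A`, and a dense subgroup of `A` consists of late
products modulo `B`, then every element is a late product modulo `B`. -/
theorem lateProducts_eq_univ_of_dense [TopologicalSpace G] [IsTopologicalGroup G] (hU : IsOpen U)
    (hφc : ∀ t, Continuous (φ t)) (hinv : ∀ t g, φ t (φ (-t) g) = g)
    (A B K : Subgroup G) [hA : A.Normal] [hB : B.Normal] (hAK : A ≤ K.topologicalClosure)
    (hK : ∀ y ∈ K, y ∈ lateProducts φ U τ B) (h : lateProducts φ U τ A = univ) :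
    lateProducts φ U τ B = univ := by
  refine eq_univ_of_forall fun g a => ?_
  obtain ⟨b, r, hr, hrg⟩ := (h ▸ mem_univ g : g ∈ lateProducts φ U τ A) a
  have hy : g * r⁻¹ ∈ A := by
    have h1 : r⁻¹ * g ∈ A := QuotientGroup.eq.1 hrg
    have h2 := hA.conj_mem _ h1 r
    simpa [mul_assoc] using h2
  have hcl : g * r⁻¹ ∈ closure (K : Set G) := hAK hy
  -- For `k` near `g * r⁻¹`, the element `k⁻¹ * g` is near `r` and inherits its window. A `k` in `K`
  -- is then realised modulo `B` at times after `b`.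
  have hev : ∀ᶠ k in 𝓝 (g * r⁻¹), FlowProduct φ U τ a b (k⁻¹ * g) := by
    have : Tendsto (fun k => k⁻¹ * g) (𝓝 (g * r⁻¹)) (𝓝 r) := by
      have : ContinuousAt (fun k => k⁻¹ * g) (g * r⁻¹) := by fun_prop
      simpa [ContinuousAt] using this
    exact this.eventually (hr.eventually hU hφc hinv)
  obtain ⟨k, hk, hkK⟩ := mem_closure_iff_nhds.1 hcl _ hev
  obtain ⟨c, w, hw, hwk⟩ := hK k hkK b
  refine ⟨c, w * (k⁻¹ * g), mul hw hk, ?_⟩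
  rw [QuotientGroup.mk_mul, hwk, ← QuotientGroup.mk_mul, mul_inv_cancel_left]

end FlowProduct

end Windows

/-! ### Unipotent one-parameter groups -/

section NilpotentExtrapolation

variable {R : Type*} [NormedRing R] [NormedAlgebra ℝ R]

/-- The exponential series is finite, and `exp a - 1` is `a` times a polynomial in `a`. -/
theorem one_sub_exp_pow_eq_zero {a : R} {m : ℕ} (ha : a ^ m = 0) :
    (1 - NormedSpace.exp a) ^ m = 0 := by
  obtain ⟨b, hb, hab⟩ : ∃ b, Commute a b ∧ NormedSpace.exp a = 1 + a * b := by
    have hm : ∀ n, m ≤ n → a ^ n = 0 := fun n hn => pow_eq_zero_of_le hn ha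
    refine ⟨∑ n ∈ Finset.range m, (((n + 1).factorial : ℝ)⁻¹) • a ^ n, ?_, ?_⟩
    · exact Commute.sum_right _ _ _ fun n _ => ((Commute.refl a).pow_right n).smul_right _
    · rw [NormedSpace.exp_eq_tsum ℝ]
      simp only
      rw [tsum_eq_sum (s := Finset.range (m + 1)), Finset.sum_range_succ', Finset.mul_sum, add_comm]
      · simp [pow_succ']
      · intro n hn
        rw [hm n (by simp at hn; omega), smul_zero]
  rw [hab, sub_add_cancel_left, ← mul_neg, hb.neg_right.mul_pow, ha, zero_mul]

/-- A unipotent one-parameter group at time `0` is a combination of its values at the times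
`q, 2 q, …, m q`, with coefficients independent of `q`. -/
theorem sum_exp_smul_eq_one [CompleteSpace R] {a : R} {m : ℕ} (ha : a ^ m = 0) (q : ℝ) :
    ∑ k ∈ Finset.range m, (-((-1) ^ (k + 1) * (m.choose (k + 1) : ℝ))) •
      NormedSpace.exp ((((k + 1 : ℕ) : ℝ) * q) • a) = 1 := by
  let : NormedAlgebra ℚ R := NormedAlgebra.restrictScalars ℚ ℝ R
  have h1 : (1 - NormedSpace.exp (q • a)) ^ m = 0 :=
    one_sub_exp_pow_eq_zero (by rw [smul_pow, ha, smul_zero])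
  rw [sub_eq_neg_add, (Commute.one_right _).add_pow, Finset.sum_range_succ'] at h1
  simp only [one_pow, mul_one, pow_zero, Nat.choose_zero_right, Nat.cast_one] at h1
  rw [add_comm, ← eq_neg_iff_add_eq_zero, ← Finset.sum_neg_distrib] at h1
  rw [h1]
  refine Finset.sum_congr rfl fun k _ => ?_
  rw [mul_smul, Nat.cast_smul_eq_nsmul, NormedSpace.exp_nsmul, neg_pow (NormedSpace.exp (q • a)),
    neg_smul, mul_smul, Nat.cast_smul_eq_nsmul, nsmul_eq_mul, ← Nat.cast_comm]
  rcases Nat.even_or_odd (k + 1) with h | h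
  · simp [h.neg_one_pow]
  · simp [h.neg_one_pow]

end NilpotentExtrapolation

/-! ### Decomposition of group elements into flow products -/

section LateProducts

open Filter Set FlowProduct

variable {E : Type*} [NormedAddCommGroup E] [NormedSpace ℝ E] [CompleteSpace E]
  {H : Type*} [TopologicalSpace H] (I : ModelWithCorners ℝ E H)
  {G : Type*} [TopologicalSpace G] [ChartedSpace H G] [Group G]
  [I.Boundaryless] [LieGroup I ∞ G] [T2Space G]

/-- For a nilpotent generator `D`, the one-parameter subgroups of an invariant closed subgroup `A`
consist of late products modulo a closed normal subgroup containing the commutators of `A`. -/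
theorem oneParam_mem_lateProducts {φ : ℝ → G →* G} {D : E →L[ℝ] E} {m : ℕ} (hD : D ^ m = 0)
    (hφ : ∀ t X s, φ t (oneParam I G X s) = oneParam I G (NormedSpace.exp (t • D) X) s)
    {U : Set G} (hU : U ∈ 𝓝 1) {τ : ℝ}
    (A B : Subgroup G) [B.Normal] (hA : IsClosed (A : Set G)) (hB : IsClosed (B : Set G))
    (hAB : ⁅A, A⁆ ≤ B) (hφA : ∀ t, ∀ g ∈ A, φ t g ∈ A) {X : E} (hX : X ∈ lieSubmodule I A hA)
    (t : ℝ) : oneParam I G X t ∈ lateProducts φ U τ B := by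
  have hU1 : (1 : G) ∈ U := mem_of_mem_nhds hU
  set c : ℕ → ℝ := fun k => -((-1) ^ (k + 1) * (m.choose (k + 1) : ℝ)) * t with hc
  -- `N` is fixed before `a` and `q`, which is possible because the coefficients do not depend on
  -- `q`.
  have hev : ∀ᶠ N : ℕ in atTop, 0 < N ∧ ∀ k ∈ Finset.range m, oneParam I G X (c k / N) ∈ U := by
    refine (eventually_gt_atTop 0).and ((Finset.eventually_all _).2 fun k _ => ?_)
    have h1 : Tendsto (fun N : ℕ => oneParam I G X (c k / N)) atTop (𝓝 (oneParam I G X 0)) :=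
      ((isOneParam_oneParam I X).continuous.tendsto 0).comp
        (tendsto_const_div_atTop_nhds_zero_nat (c k))
    rw [(isOneParam_oneParam I X).map_zero] at h1
    exact h1.eventually hU
  obtain ⟨N, hN, hNU⟩ := hev.exists
  have hN' : (N : ℝ) ≠ 0 := by positivity
  rw [← mul_div_cancel₀ t hN', (isOneParam_oneParam I X).map_nsmul]
  refine pow_mem_lateProducts B hU1 (fun a => ?_) N
  set q : ℝ := 2 * max (a + 2 * τ) τ with hq
  have hq1 : a + 2 * τ ≤ q / 2 := by rw [hq]; linarith [le_max_left (a + 2 * τ) τ]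
  have hq2 : τ ≤ q / 2 := by rw [hq]; linarith [le_max_right (a + 2 * τ) τ]
  set Y : ℕ → E := fun k => (c k / N) • NormedSpace.exp ((((k + 1 : ℕ) : ℝ) * q) • D) X with hY
  have hexp : ∀ s : ℝ, NormedSpace.exp (s • D) X ∈ lieSubmodule I A hA := fun s r => by
    rw [← hφ]; exact hφA _ _ (hX r)
  have hYmem : ∀ k, Y k ∈ lieSubmodule I A hA := fun k => Submodule.smul_mem _ _ (hexp _)
  -- The factor with index `k` sits at time `(k + 1) * q`, the right-hand part of its window having
  -- length `q / 2 ≥ τ`, as has the left-hand part.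
  have hprod : ∀ n ≤ m, ∃ w, FlowProduct φ U τ a (n * q + q / 2) w ∧
      (w : G ⧸ B) = oneParam I G (∑ k ∈ Finset.range n, Y k) 1 := by
    intro n
    induction n with
    | zero =>
      intro _
      refine ⟨1, (FlowProduct.one hU1 a).mono le_rfl (by push_cast; linarith), ?_⟩
      have := oneParam_smul I (G := G) 0 0 1
      rw [zero_smul, zero_mul, (isOneParam_oneParam I 0).map_zero] at this
      simp [this]
    | succ n ih =>
      intro hn
      obtain ⟨w, hw, hwe⟩ := ih (by omega)
      have hs : FlowProduct φ U τ (n * q + q / 2) ((n + 1 : ℕ) * q + q / 2)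
          (φ ((n + 1 : ℕ) * q) (oneParam I G X (c n / N))) :=
        FlowProduct.single (by push_cast; linarith) (by linarith)
          (hNU n (Finset.mem_range.2 (by omega)))
      refine ⟨_, hs.mul hw, ?_⟩
      rw [QuotientGroup.mk_mul, hwe, Finset.sum_range_succ,
        add_comm _ (Y n),
        mk_oneParam_add I A B hA hB hAB (hYmem n) (Submodule.sum_mem _ fun k _ => hYmem k), hφ,
        oneParam_smul, mul_one]
  obtain ⟨w, hw, hwe⟩ := hprod m le_rfl
  refine ⟨_, w, hw, hwe.trans ?_⟩
  have hsum : ∑ k ∈ Finset.range m, Y k = (t / N) • X := by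
    have h1 := congrArg (fun T : E →L[ℝ] E => (t / N) • T X) (sum_exp_smul_eq_one hD q)
    simp only [one_apply_eq_self] at h1
    rw [← h1, sum_apply, Finset.smul_sum]
    refine Finset.sum_congr rfl fun k _ => ?_
    simp only [hY, hc, smul_apply, smul_smul]
    congr 1
    ring
  rw [hsum, oneParam_smul, mul_one]

/-- In a connected solvable Lie group, every element is a product of small elements moved by a
nilpotent flow at arbitrarily late and widely separated times. -/
theorem exists_flowProduct [FiniteDimensional ℝ E] [ConnectedSpace G] [Group.IsSolvable G]
    {φ : ℝ → G →* G} {D : E →L[ℝ] E} (hD : IsNilpotent D) (hφc : ∀ t, Continuous (φ t))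
    (hinv : ∀ t g, φ t (φ (-t) g) = g)
    (hφ : ∀ t X s, φ t (oneParam I G X s) = oneParam I G (NormedSpace.exp (t • D) X) s)
    {U : Set G} (hUo : IsOpen U) (hU : (1 : G) ∈ U) (τ a : ℝ) (g : G) :
    ∃ b, FlowProduct φ U τ a b g := by
  have : IsTopologicalGroup G := topologicalGroup_of_lieGroup I ∞
  obtain ⟨m, hm⟩ := hD
  have key : ∀ n, lateProducts φ U τ (closedDerivedSeries G n) = univ := by
    intro n
    induction n with
    | zero =>
      exact eq_univ_of_forall fun y a => ⟨_, 1, FlowProduct.one hU a, QuotientGroup.eq.2 trivial⟩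
    | succ n ih =>
      refine lateProducts_eq_univ_of_dense hUo hφc hinv (closedDerivedSeries G n)
        (closedDerivedSeries G (n + 1)) (oneParamClosure I (closedDerivedSeries G n))
        (closedDerivedSeries_le_oneParamClosure I n) (fun y hy => ?_) ih
      have hgen : ∀ (X : E) (t : ℝ), (∀ s, oneParam I G X s ∈ closedDerivedSeries G n) →
          oneParam I G X t ∈ lateProducts φ U τ (closedDerivedSeries G (n + 1)) := fun X t hX =>
        oneParam_mem_lateProducts I hm hφ (hUo.mem_nhds hU) (closedDerivedSeries G n)
          (closedDerivedSeries G (n + 1)) (isClosed_closedDerivedSeries G n)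
          (isClosed_closedDerivedSeries G (n + 1)) (Subgroup.le_topologicalClosure _)
          (fun t => map_mem_closedDerivedSeries (φ t) (hφc t) n) hX t
      -- Late products are only known to form a monoid, so inverses of generators are treated
      -- separately, as `exp(-tX)`.
      induction hy using Subgroup.closure_induction'' with
      | mem x hx =>
        obtain ⟨X, hX, t, rfl⟩ := hx
        exact hgen X t hX
      | inv_mem x hx =>
        obtain ⟨X, hX, t, rfl⟩ := hx
        rw [← (isOneParam_oneParam I X).map_neg]
        exact hgen X (-t) hX
      | one => exact one_mem_lateProducts _ hU
      | mul x y _ _ hx hy => exact mul_mem_lateProducts _ hx hy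
  obtain ⟨n, hn⟩ := exists_closedDerivedSeries_eq_bot (G := G)
  obtain ⟨b, w, hw, hwg⟩ := (key n ▸ mem_univ g : g ∈ lateProducts φ U τ _) a
  rw [QuotientGroup.eq, hn, Subgroup.mem_bot, inv_mul_eq_one] at hwg
  exact ⟨b, hwg ▸ hw⟩

end LateProducts

/-! ### From flow products to chains -/

namespace AutomorphismFlow

open Relation

variable {E : Type*} [NormedAddCommGroup E] [NormedSpace ℝ E]
  {H : Type*} [TopologicalSpace H] {I : ModelWithCorners ℝ E H}
  {G : Type*} [TopologicalSpace G] [ChartedSpace H G] [Group G]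

/-- The automorphisms of the flow as group homomorphisms. -/
def hom (φ : AutomorphismFlow I G) (t : ℝ) : G →* G := MonoidHom.mk' (φ t) (φ.map_mul' t)

theorem hom_add (φ : AutomorphismFlow I G) (s t : ℝ) (g : G) :
    φ.hom (s + t) g = φ.hom s (φ.hom t g) := φ.map_add' s t g

theorem hom_zero (φ : AutomorphismFlow I G) (g : G) : φ.hom 0 g = g := φ.map_zero' g

theorem continuous_hom (φ : AutomorphismFlow I G) (t : ℝ) : Continuous (φ.hom t) :=
  (φ.contMDiff' t).continuous

/-- One jump of a chain. -/
def ChainStep (φ : AutomorphismFlow I G) (U : Set G) (τ : ℝ) (x y : G) : Prop :=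
  ∃ T, τ ≤ T ∧ y⁻¹ * φ.hom T x ∈ U

theorem existsChain_of_transGen {φ : AutomorphismFlow I G} {U : Set G} {τ : ℝ} {x y : G}
    (h : TransGen (φ.ChainStep U τ) x y) : φ.ExistsChain U τ x y := by
  induction h using TransGen.head_induction_on with
  | @single x h =>
    obtain ⟨T, hT, hTU⟩ := h
    refine ⟨1, fun i => if i = 0 then x else y, fun _ => T, le_rfl, by simp, by simp, ?_⟩
    intro i hi
    obtain rfl : i = 0 := by omega
    simpa using ⟨hT, hTU⟩
  | @head x z h _ ih =>
    obtain ⟨T, hT, hTU⟩ := h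
    obtain ⟨n, p, S, hn, hp0, hpn, hstep⟩ := ih
    refine ⟨n + 1, fun i => Nat.casesOn i x p, fun i => Nat.casesOn i T S, by omega, rfl, hpn, ?_⟩
    rintro (_ | i) hi
    · exact ⟨hT, by rw [← hp0] at hTU; exact hTU⟩
    · exact hstep i (by omega)

/-- A factor `φ_S(u)` costs two jumps: time `b - S` with error `u⁻¹`, then time `S - a` with no
error. The window margins make both times at least `τ`. -/
theorem transGen_of_flowProduct {φ : AutomorphismFlow I G} {U : Set G} (hU : (1 : G) ∈ U)
    {τ a b : ℝ} {g : G} (h : FlowProduct φ.hom U⁻¹ τ a b g) (x : G) :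
    TransGen (φ.ChainStep U τ) x (φ.hom (b - a) x * φ.hom (-a) g) := by
  induction h generalizing x with
  | @single a b S u ha hb hu =>
    refine TransGen.tail (b := φ.hom (b - S) x * u) (TransGen.single ⟨b - S, by linarith, ?_⟩)
      ⟨S - a, by linarith, ?_⟩
    · simpa using hu
    · rw [map_mul, ← hom_add, ← hom_add]
      have h1 : S - a + (b - S) = b - a := by ring
      have h2 : -a + S = S - a := by ring
      simpa [h1, h2] using hU
  | @mul a b c g h _ _ ih1 ih2 =>
    have h3 := (ih1 x).trans (ih2 _)
    rw [map_mul, ← hom_add, ← hom_add] at h3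
    have h1 : b - a + (c - b) = c - a := by ring
    have h2 : b - a + -b = -a := by ring
    rwa [h1, h2, mul_assoc, ← map_mul] at h3

/-- After time `S - a` the factor `φ_{-S}(u)` has become `u` and is discarded as an error; an exact
jump of time `b - S` completes the window. -/
theorem transGen_of_flowProduct_neg {φ : AutomorphismFlow I G} {U : Set G} (hU : (1 : G) ∈ U)
    {τ a b : ℝ} {g : G} (h : FlowProduct (fun t => φ.hom (-t)) U τ a b g) (x : G) :
    TransGen (φ.ChainStep U τ) (φ.hom (a - b) x * φ.hom a g) x := by
  induction h generalizing x with
  | @single a b S u ha hb hu =>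
    refine TransGen.tail (b := φ.hom (S - b) x) (TransGen.single ⟨S - a, by linarith, ?_⟩)
      ⟨b - S, by linarith, ?_⟩
    · rw [map_mul, ← hom_add, ← hom_add, ← hom_add]
      have h1 : S - a + (a - b) = S - b := by ring
      have h2 : S - a + (a + -S) = 0 := by ring
      simpa [h1, h2, hom_zero] using hu
    · rw [← hom_add]
      have h1 : b - S + (S - b) = 0 := by ring
      simpa [h1, hom_zero] using hU
  | @mul a b c g h _ _ ih1 ih2 =>
    have h3 := (ih2 _).trans (ih1 x)
    rw [map_mul, ← hom_add, ← hom_add] at h3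
    have h1 : a - b + (b - c) = a - c := by ring
    have h2 : a - b + b = a := by ring
    rwa [h1, h2, mul_assoc, ← map_mul] at h3

/-- The chain is routed through `1`: a decomposition of `x` for the reversed flow leads to `1`, and
one of `y` for the flow itself leads on to `y`. -/
theorem transGen_chainStep [FiniteDimensional ℝ E] [I.Boundaryless] [LieGroup I ∞ G]
    [ConnectedSpace G] [Group.IsSolvable G] {φ : AutomorphismFlow I G} (hφ : φ.IsNilpotentFlow)
    {U : Set G} (hU : U ∈ 𝓝 (1 : G)) (τ : ℝ) (x y : G) :
    TransGen (φ.ChainStep U τ) x y := by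
  have : IsTopologicalGroup G := topologicalGroup_of_lieGroup I ∞
  have : T1Space G := I.t1Space G
  have : CompleteSpace E := FiniteDimensional.complete ℝ E
  obtain ⟨D, hD, hnil⟩ := hφ
  have hφD : ∀ t X s, φ.hom t (oneParam I G X s) =
      oneParam I G (NormedSpace.exp (t • D) X) s := by
    intro t X s
    rw [map_oneParam I (φ.hom t) (φ.contMDiff' t) X s, ← hD t]
    rfl
  have hinv : ∀ t g, φ.hom t (φ.hom (-t) g) = g := fun t g => by
    rw [← hom_add, add_neg_cancel, hom_zero]
  have hU1 : (1 : G) ∈ interior U := mem_interior_iff_mem_nhds.2 hU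
  have hmono : φ.ChainStep (interior U) τ ≤ φ.ChainStep U τ :=
    fun _ _ ⟨T, hT, hTU⟩ => ⟨T, hT, interior_subset hTU⟩
  refine TransGen.mono hmono _ _ (TransGen.trans (b := (1 : G)) ?_ ?_)
  · obtain ⟨b, hb⟩ := exists_flowProduct I (φ := fun t => φ.hom (-t)) hnil.neg
      (fun t => φ.continuous_hom (-t)) (fun t g => hinv (-t) g)
      (fun t X s => by rw [hφD, smul_neg, neg_smul]) isOpen_interior hU1 τ 0 x
    simpa [hom_zero] using transGen_of_flowProduct_neg hU1 hb 1
  · obtain ⟨b, hb⟩ := exists_flowProduct I (φ := φ.hom) hnil φ.continuous_hom hinv hφD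
      isOpen_interior.inv (by simpa using hU1) τ 0 y
    simpa [hom_zero] using transGen_of_flowProduct hU1 hb 1

end AutomorphismFlow

theorem proposition4p2
    {E : Type*} [NormedAddCommGroup E] [NormedSpace ℝ E] [FiniteDimensional ℝ E]
    {H : Type*} [TopologicalSpace H] (I : ModelWithCorners ℝ E H) [I.Boundaryless]
    {G : Type*} [TopologicalSpace G] [ChartedSpace H G] [Group G] [LieGroup I ∞ G]
    [ConnectedSpace G] [Group.IsSolvable G]
    (φ : AutomorphismFlow I G) (hφ : φ.IsNilpotentFlow) :
    φ.IsChainTransitive := by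
  have h : ∀ x y, y ∈ φ.chainLimitSet x := fun x y _ hU τ _ =>
    AutomorphismFlow.existsChain_of_transGen (AutomorphismFlow.transGen_chainStep hφ hU τ x y)
  exact ⟨1, h 1 1, fun y _ => ⟨h y y, h y 1, h 1 y⟩⟩
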